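/- Let $\Omega$ be a finite set of states, let $\Delta(\Omega)\subseteq\mathbb{R}^{\Omega}$ be the simplex of beliefs, and let $p\in\Delta(\Omega)$ be a prior with full support. Let $A$ be a nonempty compact metric space of receiver actions, and let $u_S:A\to\mathbb{R}$ (the sender's state-independent utility) and $u_R:\Omega\times A\to\mathbb{R}$ (the receiver's utility) be continuous. For $\mu\in\Delta(\Omega)$ put $$\mathbf{V}(\mu)=\mathrm{co}\Big(u_S\big(\arg\max_{a\in A}\textstyle\sum_{\omega}\mu(\omega)u_R(\omega,a)\big)\Big),\qquad \overline{V}(\mu)=\max\mathbf{V}(\mu),$$ and write $V\in\mathbf{V}$ for a measurable function $V:\Delta(\Omega)\to\mathbb{R}$ with $V(\mu)\in\mathbf{V}(\mu)$ for all $\mu$. Let $\mathcal{T}_{BP}(p)$ be the set of Borel probability measures $\tau$ on $\Delta(\Omega)$ with $\int\mu\,d\tau(\mu)=p$, and let $\mathcal{T}_{CT}(p)$ be the set of $\tau\in\mathcal{T}_{BP}(p)$ for which some $V\in\mathbf{V}$ is constant on $\mathrm{supp}(\tau)$. Define the following values. * Bayesian persuasion: $\mathcal{V}_{BP}(p)=\sup\{\int\overline{V}\,d\tau:\tau\in\mathcal{T}_{BP}(p)\}$.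 * Mediation: $\mathcal{V}_{MD}(p)=\sup\{\int V\,d\tau:\tau\in\mathcal{T}_{BP}(p),\ V\in\mathbf{V},\ \int V(\mu)(\mu-p)\,d\tau(\mu)=\mathbf{0}\}$. * Cheap talk: $\mathcal{V}_{CT}(p)=\sup\{\int V\,d\tau:\tau\in\mathcal{T}_{BP}(p),\ V\in\mathbf{V},\ V\text{ constant on }\mathrm{supp}(\tau)\}$. Let $\overline{V}_{CT}$ be the quasiconcave envelope of $\overline{V}$, that is, the pointwise infimum of all quasiconcave functions on $\Delta(\Omega)$ that majorize $\overline{V}$. Assume that the full-dimensionality condition holds at $p$: the sets $\mathrm{aff}(\mathrm{supp}(\tau))\cap\Delta(\Omega)$, where $\tau$ ranges over the finitely supported elements of $\mathcal{T}_{CT}(p)$ with $\mathcal{V}_{CT}(p)\in\bigcap_{\mu\in\mathrm{supp}(\tau)}\mathbf{V}(\mu)$, have union $\Delta(\Omega)$. Then $$\mathcal{V}_{BP}(p)>\mathcal{V}_{MD}(p)\iff\text{there exists }\mu\in\Delta(\Omega)\text{ such that }\overline{V}(\mu)>\overline{V}_{CT}(p).$$ Equivalently, $\mathcal{V}_{BP}(p)>\mathcal{V}_{MD}(p)$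 if and only if $\mathcal{V}_{CT}(p)$ is not the global maximum $\max_{\mu\in\Delta(\Omega)}\overline{V}(\mu)$. -/

import Mathlib

open MeasureTheory

namespace Mediation

noncomputable section

/-- `Δ(Ω)`: beliefs about a finite state space, as points of the standard simplex in `ℝ^Ω`. -/
abbrev Belief (Ω : Type*) [Fintype Ω] : Type _ := ↥(stdSimplex ℝ Ω)

/-- The receiver's pure best responses to the belief `μ`. -/
def bestResponses {Ω A : Type*} [Fintype Ω] (uR : Ω → A → ℝ) (μ : Belief Ω) : Set A :=
  {a | ∀ b, ∑ ω, (μ : Ω → ℝ) ω * uR ω b ≤ ∑ ω, (μ : Ω → ℝ) ω * uR ω a}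

/-- The indirect value correspondence: sender payoffs from (mixed) best responses at `μ`. -/
def valueCorr {Ω A : Type*} [Fintype Ω] (uS : A → ℝ) (uR : Ω → A → ℝ) (μ : Belief Ω) : Set ℝ :=
  convexHull ℝ (uS '' bestResponses uR μ)

/-- The upper envelope `V̄(μ)`, the maximum of the (nonempty, compact) set `𝐕(μ)`. -/
def upperValue {Ω A : Type*} [Fintype Ω] (uS : A → ℝ) (uR : Ω → A → ℝ) (μ : Belief Ω) : ℝ :=
  sSup (valueCorr uS uR μ)

/-- `V` is a measurable selection of the indirect value correspondence. -/
def IsSelection {Ω A : Type*} [Fintype Ω] (uS : A → ℝ) (uR : Ω → A → ℝ)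
    (V : Belief Ω → ℝ) : Prop :=
  Measurable V ∧ ∀ μ, V μ ∈ valueCorr uS uR μ

/-- Distributions of posteriors feasible under Bayesian persuasion at `p`: the mean is `p`. -/
def feasibleBP {Ω : Type*} [Fintype Ω] (p : Belief Ω) : Set (ProbabilityMeasure (Belief Ω)) :=
  {τ | ∀ ω, ∫ μ, (μ : Ω → ℝ) ω ∂(τ : Measure (Belief Ω)) = (p : Ω → ℝ) ω}

/-- The support of a distribution of posteriors. -/
def supp {Ω : Type*} [Fintype Ω] (τ : ProbabilityMeasure (Belief Ω)) : Set (Belief Ω) :=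
  (τ : Measure (Belief Ω)).support

/-- The optimal Bayesian persuasion value. -/
def valueBP {Ω A : Type*} [Fintype Ω] (uS : A → ℝ) (uR : Ω → A → ℝ) (p : Belief Ω) : ℝ :=
  sSup {s | ∃ τ ∈ feasibleBP p, ∫ μ, upperValue uS uR μ ∂(τ : Measure (Belief Ω)) = s}

/-- The optimal mediation value: maximize the expectation of a measurable selection `V`
subject to Bayes plausibility and the truth-telling constraint `∫ V(μ) (μ - p) dτ = 0`. -/
def valueMD {Ω A : Type*} [Fintype Ω] (uS : A → ℝ) (uR : Ω → A → ℝ) (p : Belief Ω) : ℝ :=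
  sSup {s | ∃ τ ∈ feasibleBP p, ∃ V, IsSelection uS uR V ∧
    (∀ ω, ∫ μ, V μ * ((μ : Ω → ℝ) ω - (p : Ω → ℝ) ω) ∂(τ : Measure (Belief Ω)) = 0) ∧
    ∫ μ, V μ ∂(τ : Measure (Belief Ω)) = s}

/-- `τ` is implementable under cheap talk at `p` with the selection `V`, which is constant on
the support of `τ`. -/
def IsCheapTalk {Ω A : Type*} [Fintype Ω] (uS : A → ℝ) (uR : Ω → A → ℝ) (p : Belief Ω)
    (τ : ProbabilityMeasure (Belief Ω)) (V : Belief Ω → ℝ) : Prop :=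
  τ ∈ feasibleBP p ∧ IsSelection uS uR V ∧ ∃ c, ∀ μ ∈ supp τ, V μ = c

/-- Distributions of posteriors implementable under cheap talk at `p`. -/
def feasibleCT {Ω A : Type*} [Fintype Ω] (uS : A → ℝ) (uR : Ω → A → ℝ) (p : Belief Ω) :
    Set (ProbabilityMeasure (Belief Ω)) :=
  {τ | ∃ V, IsCheapTalk uS uR p τ V}

/-- The value of the sender's preferred cheap talk equilibrium. -/
def valueCT {Ω A : Type*} [Fintype Ω] (uS : A → ℝ) (uR : Ω → A → ℝ) (p : Belief Ω) : ℝ :=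
  sSup {s | ∃ τ V, IsCheapTalk uS uR p τ V ∧ ∫ μ, V μ ∂(τ : Measure (Belief Ω)) = s}

/-- The quasiconcave envelope `V̄_CT`: the pointwise infimum of all quasiconcave functions on
the simplex that majorize `V̄`. -/
def quasiconcaveEnvelope {Ω A : Type*} [Fintype Ω] (uS : A → ℝ) (uR : Ω → A → ℝ)
    (μ : Belief Ω) : ℝ :=
  sInf {r | ∃ q : (Ω → ℝ) → ℝ, QuasiconcaveOn ℝ (stdSimplex ℝ Ω) q ∧
    (∀ ν : Belief Ω, upperValue uS uR ν ≤ q ν) ∧ q μ = r}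

/-- The cheap talk hull of `s` at `p`: the union of `aff(supp τ) ∩ Δ(Ω)` over the finitely
supported `τ`, implementable under cheap talk at `p`, that attain the value `s`. -/
def cheapTalkHull {Ω A : Type*} [Fintype Ω] (uS : A → ℝ) (uR : Ω → A → ℝ) (p : Belief Ω)
    (s : ℝ) : Set (Ω → ℝ) :=
  {x | ∃ τ ∈ feasibleCT uS uR p, (∀ μ ∈ supp τ, s ∈ valueCorr uS uR μ) ∧ (supp τ).Finite ∧
    x ∈ (affineSpan ℝ (Subtype.val '' supp τ) : Set (Ω → ℝ)) ∩ stdSimplex ℝ Ω}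

/-- The full-dimensionality condition at `p`: the cheap talk hull of the optimal cheap talk
value is the whole simplex. -/
def FullDimensional {Ω A : Type*} [Fintype Ω] (uS : A → ℝ) (uR : Ω → A → ℝ)
    (p : Belief Ω) : Prop :=
  cheapTalkHull uS uR p (valueCT uS uR p) = stdSimplex ℝ Ω

end

end Mediation

namespace Mediation

/-! If cheap talk at `p` already reaches the maximum of the upper value, then persuasion ≤ cheap
talk ≤ mediation. The converse assumes that mediation does at least as well as persuasion, whose
value is called `v`.

Duality gives a linear `ℓ` majorizing the upper value with `ℓ p = v` (`exists_linear_majorant`).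
Suppose mediation attained `v` with `τ` and `V`. Then `∫ (ℓ - V) = 0` with `V ≤ ℓ`, so `V = ℓ`
almost everywhere. Truth-telling, paired with `ℓ`, then gives `∫ (ℓ - v)² = ∫ V (ℓ - v) = 0`, so `V
= v` almost everywhere, and `v` is secured by cheap talk. Since attainment is not established,
`mem_convexHull_of_lt_valueBP` runs this argument with an `ε`: for each `s < v`, `p` lies in the
convex hull of the beliefs whose upper value is at least `s`. By `le_valueCT_of_mem_convexHull`
cheap talk then attains at least `s`, so cheap talk is worth at least `v`.

Finally, on the support of any optimal cheap talk `τ`, `ℓ` is at least its mean `ℓ p`, hence equal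
to it, and so constant on the affine span of the support. Full dimensionality makes `ℓ` equal to `v`
on the whole simplex, which bounds the upper value everywhere (`upperValue_le_valueCT`).
`quasiconcaveEnvelope_eq_valueCT` translates the cheap talk value into the envelope. -/

theorem isCompact_convexHull {E : Type*} [NormedAddCommGroup E] [NormedSpace ℝ E]
    [FiniteDimensional ℝ E] {s : Set E} (hs : IsCompact s) : IsCompact (convexHull ℝ s) := by
  classical
  rcases s.eq_empty_or_nonempty with rfl | ⟨x₀, hx₀⟩
  · simp
  let d := Module.finrank ℝ E + 1
  -- Carathéodory: `d` points always suffice. Shorter combinations are padded with weight `0` at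
  -- `x₀`, so the hull is a continuous image of one compact set.
  have himg : convexHull ℝ s = (fun q : (Fin d → ℝ) × (Fin d → E) => ∑ i, q.1 i • q.2 i) ''
      (stdSimplex ℝ (Fin d) ×ˢ Set.pi Set.univ fun _ => s) := by
    apply Set.Subset.antisymm
    · intro x hx
      obtain ⟨ι, _, z, w, hz, hind, hw, hw1, rfl⟩ := eq_pos_convex_span_of_mem_convexHull hx
      have hcard : Fintype.card ι ≤ Fintype.card (Fin d) := by
        rw [Fintype.card_fin]
        exact hind.card_le_finrank_succ.trans (Nat.succ_le_succ (Submodule.finrank_le _))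
      obtain ⟨e⟩ := Function.Embedding.nonempty_of_card_le hcard
      have hw0 : ∀ i, i ∉ Set.range e → Function.extend e w 0 i = 0 := fun i hi =>
        Function.extend_apply' _ _ _ (by simpa using hi)
      refine ⟨(Function.extend e w 0, Function.extend e z fun _ => x₀), ⟨⟨fun i => ?_, ?_⟩, ?_⟩, ?_⟩
      · by_cases hi : i ∈ Set.range e
        · obtain ⟨j, rfl⟩ := hi
          simpa [e.injective.extend_apply] using (hw j).le
        · exact (hw0 i hi).ge
      · rw [← hw1]
        exact (Fintype.sum_of_injective e e.injective _ _ hw0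
          fun j => by rw [e.injective.extend_apply]).symm
      · intro i _
        by_cases hi : i ∈ Set.range e
        · obtain ⟨j, rfl⟩ := hi
          simpa [e.injective.extend_apply] using hz ⟨j, rfl⟩
        · simpa [Function.extend_apply' z (fun _ => x₀) i (by simpa using hi)] using hx₀
      · exact (Fintype.sum_of_injective e e.injective _ _
          (fun i hi => by simp only [hw0 i hi, zero_smul])
          fun j => by simp only [e.injective.extend_apply]).symm
    · rintro _ ⟨⟨w, z⟩, ⟨hw, hz⟩, rfl⟩
      exact (convex_convexHull ℝ s).sum_mem (fun i _ => hw.1 i) hw.2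
        fun i _ => subset_convexHull ℝ s (hz i trivial)
  rw [himg]
  exact ((isCompact_stdSimplex ℝ (Fin d)).prod (isCompact_univ_pi fun _ => hs)).image (by fun_prop)

/-! ### Closedness and measurability of the indirect value correspondence. -/

section Correspondence

variable {Ω A : Type*} [Fintype Ω] [MetricSpace A]
  {uS : A → ℝ} {uR : Ω → A → ℝ}

theorem isClosed_graph_bestResponses (huR : ∀ ω, Continuous (uR ω)) :
    IsClosed {x : Belief Ω × A | x.2 ∈ bestResponses uR x.1} := by
  have hμ : ∀ ω, Continuous fun x : Belief Ω × A => (x.1 : Ω → ℝ) ω := fun ω =>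
    (continuous_apply ω).comp (continuous_subtype_val.comp continuous_fst)
  have heq : {x : Belief Ω × A | x.2 ∈ bestResponses uR x.1} = ⋂ b : A, {x : Belief Ω × A |
      ∑ ω, (x.1 : Ω → ℝ) ω * uR ω b ≤ ∑ ω, (x.1 : Ω → ℝ) ω * uR ω x.2} := by
    ext x
    simp [bestResponses]
  rw [heq]
  refine isClosed_iInter fun b => isClosed_le ?_ ?_
  · exact continuous_finsetSum _ fun ω _ => (hμ ω).mul continuous_const
  · exact continuous_finsetSum _ fun ω _ => (hμ ω).mul ((huR ω).comp continuous_snd)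

variable [CompactSpace A]

/-- The set is a projection of a closed, hence compact, subset of beliefs × actions. -/
theorem isClosed_exists_bestResponse (huR : ∀ ω, Continuous (uR ω)) {C : Set A}
    (hC : IsClosed C) : IsClosed {μ : Belief Ω | ∃ a ∈ bestResponses uR μ, a ∈ C} := by
  have : {μ : Belief Ω | ∃ a ∈ bestResponses uR μ, a ∈ C} =
      Prod.fst '' ({x : Belief Ω × A | x.2 ∈ bestResponses uR x.1} ∩ Prod.snd ⁻¹' C) := by
    ext μ
    simp
  rw [this]
  exact (((isClosed_graph_bestResponses huR).inter
    (hC.preimage continuous_snd)).isCompact.image continuous_fst).isClosed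

theorem exists_bound_valueCorr (huS : Continuous uS) :
    ∃ B : ℝ, ∀ (μ : Belief Ω), ∀ x ∈ valueCorr uS uR μ, |x| ≤ B := by
  obtain ⟨B, hB⟩ := isCompact_univ.exists_bound_of_continuousOn huS.continuousOn
  refine ⟨B, fun μ x hx => abs_le.2 ?_⟩
  exact convexHull_min (t := Set.Icc (-B) B)
    (Set.image_subset_iff.2 fun b _ => abs_le.1 (hB b trivial)) (convex_Icc _ _) hx

variable [Nonempty A]

theorem exists_upperValue_eq (huS : Continuous uS) (huR : ∀ ω, Continuous (uR ω))
    (μ : Belief Ω) :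
    ∃ a ∈ bestResponses uR μ, uS a = upperValue uS uR μ ∧
      ∀ x ∈ valueCorr uS uR μ, x ≤ upperValue uS uR μ := by
  have hcont : Continuous fun a => ∑ ω, (μ : Ω → ℝ) ω * uR ω a :=
    continuous_finsetSum _ fun ω _ => continuous_const.mul (huR ω)
  have hne : (bestResponses uR μ).Nonempty := by
    obtain ⟨a, -, ha⟩ := isCompact_univ.exists_isMaxOn Set.univ_nonempty hcont.continuousOn
    exact ⟨a, fun b => ha (Set.mem_univ b)⟩
  have hcl : IsClosed (bestResponses uR μ) :=
    (isClosed_graph_bestResponses huR).preimage (Continuous.prodMk_right μ)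
  obtain ⟨a, ha, hmax⟩ := hcl.isCompact.exists_isMaxOn hne huS.continuousOn
  have hub : ∀ x ∈ valueCorr uS uR μ, x ≤ uS a := fun x hx =>
    convexHull_min (t := Set.Iic (uS a)) (Set.image_subset_iff.2 fun b hb => hmax hb)
      (convex_Iic _) hx
  have hg : IsGreatest (valueCorr uS uR μ) (uS a) :=
    ⟨subset_convexHull ℝ _ ⟨a, ha, rfl⟩, hub⟩
  have : upperValue uS uR μ = uS a := hg.csSup_eq
  exact ⟨a, ha, this.symm, this ▸ hub⟩

theorem le_upperValue (huS : Continuous uS) (huR : ∀ ω, Continuous (uR ω)) {μ : Belief Ω}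
    {x : ℝ} (hx : x ∈ valueCorr uS uR μ) : x ≤ upperValue uS uR μ := by
  obtain ⟨_, _, _, h⟩ := exists_upperValue_eq huS huR μ
  exact h x hx

theorem upperValue_mem (huS : Continuous uS) (huR : ∀ ω, Continuous (uR ω)) (μ : Belief Ω) :
    upperValue uS uR μ ∈ valueCorr uS uR μ := by
  obtain ⟨a, ha, h, _⟩ := exists_upperValue_eq huS huR μ
  exact subset_convexHull ℝ _ ⟨a, ha, h⟩

theorem isClosed_le_upperValue (huS : Continuous uS) (huR : ∀ ω, Continuous (uR ω)) (s : ℝ) :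
    IsClosed {μ : Belief Ω | s ≤ upperValue uS uR μ} := by
  convert isClosed_exists_bestResponse huR (isClosed_Ici.preimage huS : IsClosed (uS ⁻¹' Set.Ici s))
    using 3 with μ
  constructor
  · intro h
    obtain ⟨a, ha, hu, _⟩ := exists_upperValue_eq huS huR μ
    exact ⟨a, ha, h.trans hu.ge⟩
  · rintro ⟨a, ha, h⟩
    exact le_trans h (le_upperValue huS huR (subset_convexHull ℝ _ ⟨a, ha, rfl⟩))

theorem measurable_upperValue (huS : Continuous uS) (huR : ∀ ω, Continuous (uR ω)) :
    Measurable (upperValue uS uR) :=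
  measurable_of_Ici fun s => (isClosed_le_upperValue huS huR s).measurableSet

/-- A convex hull in `ℝ` is an interval, so membership splits into a condition from above and one
from below, each closed in `μ`. -/
theorem mem_valueCorr_iff (huS : Continuous uS) (huR : ∀ ω, Continuous (uR ω)) {s : ℝ}
    {μ : Belief Ω} : s ∈ valueCorr uS uR μ ↔
      s ≤ upperValue uS uR μ ∧ ∃ a ∈ bestResponses uR μ, a ∈ uS ⁻¹' Set.Iic s := by
  constructor
  · intro h
    refine ⟨le_upperValue huS huR h, ?_⟩
    by_contra! hcon
    have : valueCorr uS uR μ ⊆ Set.Ioi s :=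
      convexHull_min (Set.image_subset_iff.2 fun b hb =>
      show s < uS b from not_le.1 fun h => hcon b hb h) (convex_Ioi _)
    exact lt_irrefl s (this h)
  · rintro ⟨h, a, ha, has⟩
    have hIcc := (convex_convexHull ℝ (uS '' bestResponses uR μ)).ordConnected.out
      (subset_convexHull ℝ _ ⟨a, ha, rfl⟩) (upperValue_mem huS huR μ)
    exact hIcc ⟨has, h⟩

theorem isClosed_mem_valueCorr (huS : Continuous uS) (huR : ∀ ω, Continuous (uR ω)) (s : ℝ) :
    IsClosed {μ : Belief Ω | s ∈ valueCorr uS uR μ} := by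
  simp only [mem_valueCorr_iff huS huR]
  exact (isClosed_le_upperValue huS huR s).inter
    (isClosed_exists_bestResponse huR (isClosed_Iic.preimage huS))

theorem isSelection_upperValue (huS : Continuous uS) (huR : ∀ ω, Continuous (uR ω)) :
    IsSelection uS uR (upperValue uS uR) :=
  ⟨measurable_upperValue huS huR, upperValue_mem huS huR⟩

open Classical in
-- Supplies the selection that turns any `τ` supported where `s` is available into a cheap talk
-- outcome of value `s`.
theorem isSelection_ite (huS : Continuous uS) (huR : ∀ ω, Continuous (uR ω)) (s : ℝ) :
    IsSelection uS uR fun μ => if s ∈ valueCorr uS uR μ then s else upperValue uS uR μ := by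
  refine ⟨Measurable.ite (isClosed_mem_valueCorr huS huR s).measurableSet measurable_const
    (measurable_upperValue huS huR), fun μ => ?_⟩
  dsimp only
  split_ifs with h
  exacts [h, upperValue_mem huS huR μ]

theorem exists_isMax_upperValue (huS : Continuous uS) (huR : ∀ ω, Continuous (uR ω))
    [Nonempty (Belief Ω)] : ∃ μ₀, ∀ μ, upperValue uS uR μ ≤ upperValue uS uR μ₀ := by
  have husc : UpperSemicontinuous (upperValue uS uR) :=
    upperSemicontinuous_iff_isClosed_preimage.2 fun s => isClosed_le_upperValue huS huR s
  obtain ⟨μ₀, -, h⟩ := (husc.upperSemicontinuousOn Set.univ).exists_isMaxOn Set.univ_nonempty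
    isCompact_univ
  exact ⟨μ₀, fun μ => h (Set.mem_univ μ)⟩

end Correspondence
-- Barycenters of belief distributions and persuasion duality.
section Measures

variable {Ω : Type*} [Fintype Ω]

theorem continuous_coord (ω : Ω) : Continuous fun μ : Belief Ω => (μ : Ω → ℝ) ω :=
  (continuous_apply ω).comp continuous_subtype_val

theorem integrable_coord (m : Measure (Belief Ω)) [IsFiniteMeasure m] (ω : Ω) :
    Integrable (fun μ : Belief Ω => (μ : Ω → ℝ) ω) m :=
  (continuous_coord ω).integrable_of_hasCompactSupport (HasCompactSupport.of_compactSpace _)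

theorem integrable_of_abs_le {m : Measure (Belief Ω)} [IsFiniteMeasure m] {g : Belief Ω → ℝ}
    (hg : Measurable g) {B : ℝ} (hB : ∀ μ, |g μ| ≤ B) : Integrable g m :=
  Integrable.of_bound hg.aestronglyMeasurable B (Filter.Eventually.of_forall hB)

theorem linear_eq_sum (ℓ : (Ω → ℝ) →ₗ[ℝ] ℝ) : ∃ c : Ω → ℝ, ∀ x, ℓ x = ∑ ω, x ω * c ω := by
  classical
  exact ⟨_, fun x => LinearMap.pi_apply_eq_sum_univ ℓ x⟩

theorem continuous_linear_belief (ℓ : (Ω → ℝ) →ₗ[ℝ] ℝ) :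
    Continuous fun μ : Belief Ω => ℓ (μ : Ω → ℝ) :=
  ℓ.continuous_of_finiteDimensional.comp continuous_subtype_val

theorem integral_linear {p : Belief Ω} {τ : ProbabilityMeasure (Belief Ω)}
    (hτ : τ ∈ feasibleBP p) (ℓ : (Ω → ℝ) →ₗ[ℝ] ℝ) :
    ∫ μ, ℓ (μ : Ω → ℝ) ∂(τ : Measure (Belief Ω)) = ℓ (p : Ω → ℝ) := by
  obtain ⟨c, hc⟩ := linear_eq_sum ℓ
  simp only [hc]
  rw [integral_finsetSum _ fun ω _ => (integrable_coord _ ω).mul_const _]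
  exact Finset.sum_congr rfl fun ω _ => by rw [integral_mul_const, hτ ω]

theorem integral_mul_linear_sub {p : Belief Ω} {τ : ProbabilityMeasure (Belief Ω)}
    {V : Belief Ω → ℝ} (hV : Measurable V) {B : ℝ} (hB : ∀ μ, |V μ| ≤ B)
    (hτ : ∀ ω, ∫ μ, V μ * ((μ : Ω → ℝ) ω - (p : Ω → ℝ) ω) ∂(τ : Measure (Belief Ω)) = 0)
    (ℓ : (Ω → ℝ) →ₗ[ℝ] ℝ) :
    ∫ μ, V μ * (ℓ (μ : Ω → ℝ) - ℓ (p : Ω → ℝ)) ∂(τ : Measure (Belief Ω)) = 0 := by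
  obtain ⟨c, hc⟩ := linear_eq_sum ℓ
  have hrw : ∀ μ : Belief Ω, V μ * (ℓ (μ : Ω → ℝ) - ℓ (p : Ω → ℝ)) =
      ∑ ω, V μ * ((μ : Ω → ℝ) ω - (p : Ω → ℝ) ω) * c ω := fun μ => by
    rw [hc, hc, ← Finset.sum_sub_distrib, Finset.mul_sum]
    exact Finset.sum_congr rfl fun ω _ => by ring
  simp only [hrw]
  rw [integral_finsetSum]
  · exact Finset.sum_eq_zero fun ω _ => by rw [integral_mul_const, hτ ω, zero_mul]
  · intro ω _
    refine Integrable.mul_const ?_ _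
    exact ((integrable_coord _ ω).sub (integrable_const _)).bdd_mul
      hV.aestronglyMeasurable (Filter.Eventually.of_forall hB)

theorem dirac_mem_feasibleBP (p : Belief Ω) :
    (⟨Measure.dirac p, inferInstance⟩ : ProbabilityMeasure (Belief Ω)) ∈ feasibleBP p :=
  fun ω => integral_dirac (fun μ : Belief Ω => (μ : Ω → ℝ) ω) p

theorem mem_convexHull_of_supp_subset {p : Belief Ω} {τ : ProbabilityMeasure (Belief Ω)}
    (hτ : τ ∈ feasibleBP p) {K : Set (Belief Ω)} (hK : IsClosed K) (hsupp : supp τ ⊆ K) :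
    (p : Ω → ℝ) ∈ convexHull ℝ (Subtype.val '' K) := by
  have hcl : IsClosed (convexHull ℝ (Subtype.val '' K)) :=
    (isCompact_convexHull (hK.isCompact.image continuous_subtype_val)).isClosed
  have hmean : ∫ μ, (μ : Ω → ℝ) ∂(τ : Measure (Belief Ω)) = (p : Ω → ℝ) := by
    ext ω
    rw [eval_integral (integrable_coord _), hτ ω]
  rw [← hmean]
  refine (convex_convexHull ℝ _).integral_mem hcl ?_ (Integrable.of_eval (integrable_coord _))
  filter_upwards [Measure.support_mem_ae (μ := (τ : Measure (Belief Ω)))] with μ hμ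
  exact subset_convexHull ℝ _ ⟨μ, hsupp hμ, rfl⟩

theorem exists_feasibleBP_of_mem_convexHull {p : Belief Ω} {K : Set (Belief Ω)} (hK : IsClosed K)
    (hp : (p : Ω → ℝ) ∈ convexHull ℝ (Subtype.val '' K)) :
    ∃ τ ∈ feasibleBP p, supp τ ⊆ K := by
  suffices h : convexHull ℝ (Subtype.val '' K) ⊆ {x : Ω → ℝ | ∃ m : Measure (Belief Ω),
      IsProbabilityMeasure m ∧ K ∈ ae m ∧ ∀ ω, ∫ μ, (μ : Ω → ℝ) ω ∂m = x ω} by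
    obtain ⟨m, hm, hKm, hmean⟩ := h hp
    exact ⟨⟨m, hm⟩, hmean, Measure.support_subset_of_isClosed hK hKm⟩
  refine convexHull_min ?_ ?_
  · rintro _ ⟨μ, hμ, rfl⟩
    refine ⟨Measure.dirac μ, inferInstance, ?_, fun ω =>
      integral_dirac (fun μ : Belief Ω => (μ : Ω → ℝ) ω) μ⟩
    exact (mem_ae_dirac_iff hK.measurableSet).2 hμ
  · rintro x ⟨m, hm, hKm, hx⟩ y ⟨n, hn, hKn, hy⟩ a b ha hb hab
    refine ⟨ENNReal.ofReal a • m + ENNReal.ofReal b • n, ⟨?_⟩, ?_, fun ω => ?_⟩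
    · simp [← ENNReal.ofReal_add ha hb, hab]
    · rw [mem_ae_iff] at hKm hKn ⊢
      simp [hKm, hKn]
    · rw [integral_add_measure ((integrable_coord m ω).smul_measure ENNReal.ofReal_ne_top)
        ((integrable_coord n ω).smul_measure ENNReal.ofReal_ne_top), integral_smul_measure,
        integral_smul_measure, hx, hy, ENNReal.toReal_ofReal ha, ENNReal.toReal_ofReal hb]
      simp

/-- Pairs of the first moment of a finite measure and a lower bound for its integral of `g`. -/
def momentCone (g : Belief Ω → ℝ) (hg : ∀ (m : Measure (Belief Ω)) [IsFiniteMeasure m],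
    Integrable g m) : PointedCone ℝ ((Ω → ℝ) × ℝ) where
  carrier := {z | ∃ m : Measure (Belief Ω), IsFiniteMeasure m ∧
    (∀ ω, ∫ μ, (μ : Ω → ℝ) ω ∂m = z.1 ω) ∧ z.2 ≤ ∫ μ, g μ ∂m}
  zero_mem' := ⟨0, inferInstance, by simp, by simp⟩
  add_mem' := by
    rintro x y ⟨m, hm, hx, hx'⟩ ⟨n, hn, hy, hy'⟩
    refine ⟨m + n, inferInstance, fun ω => ?_, ?_⟩
    · rw [integral_add_measure (integrable_coord m ω) (integrable_coord n ω), hx, hy]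
      rfl
    · rw [integral_add_measure (hg m) (hg n)]
      exact add_le_add hx' hy'
  smul_mem' := by
    rintro ⟨c, hc⟩ x ⟨m, hm, hx, hx'⟩
    refine ⟨ENNReal.ofReal c • m, Measure.smul_finite m ENNReal.ofReal_ne_top, fun ω => ?_, ?_⟩
    · rw [integral_smul_measure, hx, ENNReal.toReal_ofReal hc]
      rfl
    · rw [integral_smul_measure, ENNReal.toReal_ofReal hc]
      exact mul_le_mul_of_nonneg_left hx' hc

/-- Duality for persuasion, from the M. Riesz extension theorem: the functional `(x, t) ↦ v * ∑ x -
t`, on pairs with `x` a multiple of `p`, extends to one nonnegative on the whole moment cone. -/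
theorem exists_linear_majorant {g : Belief Ω → ℝ} (hg : Measurable g) {B : ℝ}
    (hB : ∀ μ, |g μ| ≤ B) {p : Belief Ω} (hp : ∀ ω, 0 < (p : Ω → ℝ) ω) {v : ℝ}
    (hv : ∀ τ ∈ feasibleBP p, ∫ μ, g μ ∂(τ : Measure (Belief Ω)) ≤ v) :
    ∃ ℓ : (Ω → ℝ) →ₗ[ℝ] ℝ, (∀ μ : Belief Ω, g μ ≤ ℓ (μ : Ω → ℝ)) ∧ ℓ (p : Ω → ℝ) = v := by
  classical
  have hgi : ∀ (m : Measure (Belief Ω)) [IsFiniteMeasure m], Integrable g m :=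
    fun m _ => integrable_of_abs_le hg hB
  let D : Submodule ℝ ((Ω → ℝ) × ℝ) :=
    (Submodule.span ℝ {(p : Ω → ℝ)}).comap (LinearMap.fst ℝ (Ω → ℝ) ℝ)
  let F : (Ω → ℝ) × ℝ →ₗ[ℝ] ℝ :=
    v • (∑ ω, LinearMap.proj ω) ∘ₗ LinearMap.fst ℝ (Ω → ℝ) ℝ - LinearMap.snd ℝ (Ω → ℝ) ℝ
  have hF : ∀ x t, F (x, t) = v * ∑ ω, x ω - t := fun x t => by simp [F]
  have hsum : ∑ ω, (p : Ω → ℝ) ω = 1 := p.2.2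
  have hnonneg : ∀ z : D, (z : (Ω → ℝ) × ℝ) ∈ momentCone g hgi → 0 ≤ F.domRestrict D z := by
    rintro ⟨⟨x, t⟩, hxD⟩ ⟨m, hm, hmx, hmt⟩
    obtain ⟨a, rfl⟩ := Submodule.mem_span_singleton.1 hxD
    change 0 ≤ F _
    rw [hF]
    -- Coordinates of beliefs sum to `1`, so the multiple of `p` is the total mass. Positive mass is
    -- normalized to a distribution in `feasibleBP p`; zero mass forces `m = 0`.
    have hmass : m.real Set.univ = a := by
      have h1 : ∫ μ : Belief Ω, ∑ ω, (μ : Ω → ℝ) ω ∂m = a := by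
        rw [integral_finsetSum _ fun ω _ => integrable_coord m ω, Finset.sum_congr rfl
          fun ω _ => hmx ω]
        simp [← Finset.mul_sum, hsum]
      have h2 : ∀ μ : Belief Ω, ∑ ω, (μ : Ω → ℝ) ω = 1 := fun μ => μ.2.2
      simpa [h2] using h1
    have hval : v * ∑ ω, (a • (p : Ω → ℝ)) ω = v * a := by
      simp [← Finset.mul_sum, hsum]
    change 0 ≤ v * ∑ ω, (a • (p : Ω → ℝ)) ω - t
    rw [hval]
    rcases (measureReal_nonneg.trans_eq hmass).eq_or_lt with ha | ha
    · have hm0 : m = 0 := by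
        rw [← Measure.measure_univ_eq_zero, ← measureReal_eq_zero_iff, hmass, ha]
      subst hm0
      simp at hmt
      rw [← ha]
      linarith
    · have hτ : IsProbabilityMeasure (ENNReal.ofReal a⁻¹ • m) := ⟨by
        have hmu : m Set.univ = ENNReal.ofReal a := by
          rw [← hmass, ofReal_measureReal]
        simp only [Measure.smul_apply, smul_eq_mul, hmu]
        rw [← ENNReal.ofReal_mul (inv_nonneg.2 ha.le), inv_mul_cancel₀ ha.ne', ENNReal.ofReal_one]⟩
      have hle := hv ⟨_, hτ⟩ fun ω => by
        change ∫ μ : Belief Ω, (μ : Ω → ℝ) ω ∂(ENNReal.ofReal a⁻¹ • m) = _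
        rw [integral_smul_measure, hmx, ENNReal.toReal_ofReal (inv_nonneg.2 ha.le)]
        simp [ha.ne']
      change ∫ μ, g μ ∂(ENNReal.ofReal a⁻¹ • m) ≤ v at hle
      rw [integral_smul_measure, ENNReal.toReal_ofReal (inv_nonneg.2 ha.le), smul_eq_mul,
        inv_mul_le_iff₀ ha] at hle
      change t ≤ _ at hmt
      linarith
  have hdense : ∀ y : (Ω → ℝ) × ℝ, ∃ z : D, (z : (Ω → ℝ) × ℝ) + y ∈ momentCone g hgi := by
    rintro ⟨x, t⟩
    -- Full support of `p` enters here: a large multiple of `p` makes any vector nonnegative, hence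
    -- the first moment of a measure on the vertices.
    obtain ⟨a, ha⟩ : ∃ a : ℝ, ∀ ω, 0 ≤ a * (p : Ω → ℝ) ω + x ω := by
      have : ∀ᶠ a : ℝ in Filter.atTop, ∀ ω, -x ω ≤ a * (p : Ω → ℝ) ω :=
        Filter.eventually_all.2 fun ω =>
          (Filter.tendsto_id.atTop_mul_const (hp ω)).eventually_ge_atTop _
      obtain ⟨a, ha⟩ := this.exists
      exact ⟨a, fun ω => by linarith [ha ω]⟩
    let vert : Ω → Belief Ω := fun ω => ⟨Pi.single ω 1, single_mem_stdSimplex ℝ ω⟩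
    let m : Measure (Belief Ω) :=
      ∑ ω, ENNReal.ofReal (a * (p : Ω → ℝ) ω + x ω) • Measure.dirac (vert ω)
    have hmi : ∀ h : Belief Ω → ℝ, StronglyMeasurable h →
        ∫ μ, h μ ∂m = ∑ ω, (a * (p : Ω → ℝ) ω + x ω) * h (vert ω) := fun h hh => by
      rw [integral_finsetSum_measure fun ω _ =>
        (integrable_dirac' hh (by simp)).smul_measure ENNReal.ofReal_ne_top]
      refine Finset.sum_congr rfl fun ω _ => ?_
      rw [integral_smul_measure, integral_dirac, ENNReal.toReal_ofReal (ha ω), smul_eq_mul]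
    have hmf : IsFiniteMeasure m := ⟨by
      simp [m, Measure.finsetSum_apply, ENNReal.sum_lt_top]⟩
    refine ⟨⟨(a • (p : Ω → ℝ), ∫ μ, g μ ∂m - t), Submodule.smul_mem _ a
      (Submodule.mem_span_singleton_self _)⟩, m, hmf, fun ω => ?_, ?_⟩
    · rw [hmi _ (continuous_coord ω).stronglyMeasurable]
      simp [vert, Pi.single_apply]
    · simp
  obtain ⟨G, hGD, hG⟩ := riesz_extension (momentCone g hgi) ⟨D, F.domRestrict D⟩ hnonneg hdense
  have hGF : ∀ z ∈ D, G z = F z := fun z hz => hGD ⟨z, hz⟩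
  -- So `G (x, t) = ℓ x - t`, and nonnegativity at the point mass on `μ` reads `g μ ≤ ℓ μ`.
  have h01 : G (0, 1) = -1 := by
    rw [hGF _ (by simp [D]), hF]
    simp
  refine ⟨G ∘ₗ LinearMap.inl ℝ (Ω → ℝ) ℝ, fun μ => ?_, ?_⟩
  · have h0 := hG ((μ : Ω → ℝ), g μ) ⟨Measure.dirac μ, inferInstance,
      fun ω => integral_dirac (fun μ : Belief Ω => (μ : Ω → ℝ) ω) μ,
      (integral_dirac g μ).ge⟩
    have hdec : ((μ : Ω → ℝ), g μ) = ((μ : Ω → ℝ), (0 : ℝ)) + g μ • ((0 : Ω → ℝ), (1 : ℝ)) := by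
      simp
    rw [hdec, map_add, map_smul, h01] at h0
    simp only [smul_eq_mul] at h0
    change g μ ≤ G ((μ : Ω → ℝ), 0)
    linarith
  · change G ((p : Ω → ℝ), 0) = v
    rw [hGF _ (Submodule.mem_span_singleton_self _), hF, hsum]
    simp

end Measures

/-! ### Comparing the three values and securing payoffs by cheap talk. -/

section Values

variable {Ω A : Type*} [Fintype Ω] {uS : A → ℝ} {uR : Ω → A → ℝ} {p : Belief Ω}

theorem ae_eq_of_eqOn_supp {τ : ProbabilityMeasure (Belief Ω)} {V : Belief Ω → ℝ} {c : ℝ}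
    (h : ∀ μ ∈ supp τ, V μ = c) : V =ᵐ[(τ : Measure (Belief Ω))] fun _ => c := by
  filter_upwards [Measure.support_mem_ae (μ := (τ : Measure (Belief Ω)))] with μ hμ
  exact h μ hμ

theorem integral_eq_of_eqOn_supp {τ : ProbabilityMeasure (Belief Ω)} {V : Belief Ω → ℝ} {c : ℝ}
    (h : ∀ μ ∈ supp τ, V μ = c) : ∫ μ, V μ ∂(τ : Measure (Belief Ω)) = c := by
  rw [integral_congr_ae (ae_eq_of_eqOn_supp h)]
  simp

theorem IsCheapTalk.truthTelling {τ : ProbabilityMeasure (Belief Ω)} {V : Belief Ω → ℝ}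
    (h : IsCheapTalk uS uR p τ V) (ω : Ω) :
    ∫ μ, V μ * ((μ : Ω → ℝ) ω - (p : Ω → ℝ) ω) ∂(τ : Measure (Belief Ω)) = 0 := by
  obtain ⟨hτ, -, c, hc⟩ := h
  have hae : (fun μ : Belief Ω => V μ * ((μ : Ω → ℝ) ω - (p : Ω → ℝ) ω))
      =ᵐ[(τ : Measure (Belief Ω))] fun μ => c * ((μ : Ω → ℝ) ω - (p : Ω → ℝ) ω) := by
    filter_upwards [ae_eq_of_eqOn_supp hc] with μ hμ
    rw [hμ]
  rw [integral_congr_ae hae, integral_const_mul,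
    integral_sub (integrable_coord _ ω) (integrable_const _), hτ ω]
  simp

theorem integral_le_of_forall_le {f : Belief Ω → ℝ} {τ : ProbabilityMeasure (Belief Ω)}
    (hf : Integrable f (τ : Measure (Belief Ω))) {M : ℝ} (h : ∀ μ, f μ ≤ M) :
    ∫ μ, f μ ∂(τ : Measure (Belief Ω)) ≤ M :=
  (integral_mono hf (integrable_const M) h).trans_eq (by simp)

variable [MetricSpace A] [CompactSpace A]

theorem IsSelection.integrable (huS : Continuous uS) {V : Belief Ω → ℝ}
    (hV : IsSelection uS uR V) (m : Measure (Belief Ω)) [IsFiniteMeasure m] : Integrable V m := by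
  obtain ⟨B, hB⟩ := exists_bound_valueCorr (uR := uR) huS
  exact integrable_of_abs_le hV.1 fun μ => hB μ _ (hV.2 μ)

theorem IsCheapTalk.le_valueCT (huS : Continuous uS) {τ : ProbabilityMeasure (Belief Ω)}
    {V : Belief Ω → ℝ} (h : IsCheapTalk uS uR p τ V) :
    ∫ μ, V μ ∂(τ : Measure (Belief Ω)) ≤ valueCT uS uR p := by
  obtain ⟨B, hB⟩ := exists_bound_valueCorr (uR := uR) huS
  refine le_csSup ⟨B, ?_⟩ ⟨τ, V, h, rfl⟩
  rintro _ ⟨σ, W, hW, rfl⟩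
  exact integral_le_of_forall_le (hW.2.1.integrable huS _)
    fun μ => le_of_abs_le (hB μ _ (hW.2.1.2 μ))

variable [Nonempty A]

theorem integral_upperValue_le_valueBP (huS : Continuous uS) (huR : ∀ ω, Continuous (uR ω))
    {τ : ProbabilityMeasure (Belief Ω)} (hτ : τ ∈ feasibleBP p) :
    ∫ μ, upperValue uS uR μ ∂(τ : Measure (Belief Ω)) ≤ valueBP uS uR p := by
  obtain ⟨B, hB⟩ := exists_bound_valueCorr (uR := uR) huS
  refine le_csSup ⟨B, ?_⟩ ⟨τ, hτ, rfl⟩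
  rintro _ ⟨σ, -, rfl⟩
  exact integral_le_of_forall_le ((isSelection_upperValue huS huR).integrable huS _)
    fun μ => le_of_abs_le (hB μ _ (upperValue_mem huS huR μ))

theorem valueBP_le (huS : Continuous uS) (huR : ∀ ω, Continuous (uR ω)) {M : ℝ}
    (hM : ∀ μ : Belief Ω, upperValue uS uR μ ≤ M) : valueBP uS uR p ≤ M := by
  refine csSup_le ⟨_, _, dirac_mem_feasibleBP p, rfl⟩ ?_
  rintro _ ⟨σ, -, rfl⟩
  exact integral_le_of_forall_le ((isSelection_upperValue huS huR).integrable huS _) hM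

theorem isCheapTalk_dirac (huS : Continuous uS) (huR : ∀ ω, Continuous (uR ω)) :
    IsCheapTalk uS uR p ⟨Measure.dirac p, inferInstance⟩ (upperValue uS uR) := by
  refine ⟨dirac_mem_feasibleBP p, isSelection_upperValue huS huR, upperValue uS uR p, ?_⟩
  intro μ hμ
  have hsub : (Measure.dirac p).support ⊆ {p} := Measure.support_subset_of_isClosed
    isClosed_singleton ((mem_ae_dirac_iff (measurableSet_singleton p)).2 rfl)
  rw [show μ = p from hsub hμ]

theorem valueCT_le_of_forall (huS : Continuous uS) (huR : ∀ ω, Continuous (uR ω)) {M : ℝ}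
    (h : ∀ τ V, IsCheapTalk uS uR p τ V → ∫ μ, V μ ∂(τ : Measure (Belief Ω)) ≤ M) :
    valueCT uS uR p ≤ M := by
  refine csSup_le ⟨_, _, _, isCheapTalk_dirac huS huR, rfl⟩ ?_
  rintro _ ⟨τ, V, hV, rfl⟩
  exact h τ V hV

theorem valueCT_le_valueMD (huS : Continuous uS) (huR : ∀ ω, Continuous (uR ω)) :
    valueCT uS uR p ≤ valueMD uS uR p := by
  obtain ⟨B, hB⟩ := exists_bound_valueCorr (uR := uR) huS
  refine valueCT_le_of_forall huS huR fun τ V ⟨hτ, hV, c, hc⟩ => ?_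
  refine le_csSup ⟨B, ?_⟩ ⟨τ, hτ, V, hV, fun ω => ?_, rfl⟩
  · rintro _ ⟨σ, -, W, hW, -, rfl⟩
    exact integral_le_of_forall_le (hW.integrable huS _)
      fun μ => le_of_abs_le (hB μ _ (hW.2 μ))
  · exact IsCheapTalk.truthTelling ⟨hτ, hV, c, hc⟩ ω

/-- If `p` averages beliefs whose upper value is at least `s`, cheap talk secures `s` at `p`. -/
theorem le_valueCT_of_mem_convexHull (huS : Continuous uS) (huR : ∀ ω, Continuous (uR ω)) {s : ℝ}
    (hp : (p : Ω → ℝ) ∈ convexHull ℝ (Subtype.val '' {μ : Belief Ω | s ≤ upperValue uS uR μ})) :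
    s ≤ valueCT uS uR p := by
  classical
  by_cases hsp : s ≤ upperValue uS uR p
  · refine hsp.trans ?_
    have h := (isCheapTalk_dirac (p := p) huS huR).le_valueCT huS
    exact (integral_dirac (upperValue uS uR) p).ge.trans h
  have hK := isClosed_mem_valueCorr (Ω := Ω) huS huR s
  -- The upper value may exceed `s`, but cheap talk needs exactly `s`. Each belief is therefore
  -- moved toward `p` until `s` itself is available.
  suffices hp' : (p : Ω → ℝ) ∈ convexHull ℝ (Subtype.val '' {μ | s ∈ valueCorr uS uR μ}) by
    obtain ⟨τ, hτ, hsupp⟩ := exists_feasibleBP_of_mem_convexHull hK hp'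
    have hs : ∀ μ ∈ supp τ, (if s ∈ valueCorr uS uR μ then s else upperValue uS uR μ) = s :=
      fun μ hμ => if_pos (hsupp hμ)
    have h := IsCheapTalk.le_valueCT huS (p := p) ⟨hτ, isSelection_ite huS huR s, s, hs⟩
    rwa [integral_eq_of_eqOn_supp hs] at h
  by_contra hnot
  obtain ⟨f, u, hfu, hup⟩ := geometric_hahn_banach_closed_point (convex_convexHull ℝ _)
    (isCompact_convexHull (hK.isCompact.image continuous_subtype_val)).isClosed hnot
  suffices hlt : convexHull ℝ (Subtype.val '' {μ : Belief Ω | s ≤ upperValue uS uR μ}) ⊆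
      {x : Ω → ℝ | f x < f p} from lt_irrefl (f p) (hlt hp)
  refine convexHull_min ?_ (convex_halfSpace_lt f.toLinearMap.isLinear _)
  rintro _ ⟨μ, hμ, rfl⟩
  let γ : ℝ → Ω → ℝ := fun t => (p : Ω → ℝ) + t • ((μ : Ω → ℝ) - (p : Ω → ℝ))
  have hγ : ∀ t ∈ Set.Icc (0 : ℝ) 1, γ t ∈ stdSimplex ℝ Ω := fun t ht =>
    (convex_stdSimplex ℝ Ω).add_smul_sub_mem p.2 μ.2 ht
  let c : Set.Icc (0 : ℝ) 1 → Belief Ω := fun t => ⟨γ t, hγ t t.2⟩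
  have hc : Continuous c := by
    refine Continuous.subtype_mk ?_ _
    fun_prop
  have hT : IsClosed {t | s ≤ upperValue uS uR (c t)} :=
    (isClosed_le_upperValue huS huR s).preimage hc
  have hc1 : c 1 = μ := Subtype.ext (by simp [c, γ]; rfl)
  have hc0 : c 0 = p := Subtype.ext (by simp [c, γ]; rfl)
  -- First point on the segment from `p` to `μ` where the upper value reaches `s`. Before it some
  -- best response pays at most `s`; by closedness the same holds at `t`, so `s` is a value there.
  obtain ⟨t, ht, htmin⟩ := hT.isCompact.exists_isLeast
    ⟨1, show s ≤ upperValue uS uR (c 1) by rw [hc1]; exact hμ⟩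
  have ht0 : 0 < t := by
    refine lt_of_le_of_ne t.2.1 ?_
    rintro rfl
    exact hsp (hc0 ▸ ht)
  have hlow : t ∈ {r | ∃ a ∈ bestResponses uR (c r), a ∈ uS ⁻¹' Set.Iic s} := by
    have hcl : IsClosed {r | ∃ a ∈ bestResponses uR (c r), a ∈ uS ⁻¹' Set.Iic s} :=
      (isClosed_exists_bestResponse huR (isClosed_Iic.preimage huS)).preimage hc
    have hsub : Set.Iio t ⊆ {r | ∃ a ∈ bestResponses uR (c r), a ∈ uS ⁻¹' Set.Iic s} := by
      intro r hr
      obtain ⟨a, ha, hua, -⟩ := exists_upperValue_eq huS huR (c r)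
      refine ⟨a, ha, ?_⟩
      by_contra hcon
      have hle : s ≤ upperValue uS uR (c r) := hua ▸ (not_le.1 hcon).le
      exact absurd (htmin hle) (not_le.2 hr)
    refine hcl.closure_subset_iff.2 hsub ?_
    rw [closure_Iio' (a := t) ⟨0, ht0⟩]
    exact Set.mem_Iic.2 le_rfl
  have hmem : f (γ t) < u :=
    hfu _ (subset_convexHull ℝ _ ⟨c t, (mem_valueCorr_iff huS huR).2 ⟨ht, hlow⟩, rfl⟩)
  have hγt : f (γ t) = f p + (t : ℝ) * (f μ - f p) := by simp [γ]
  have ht0' : (0 : ℝ) < t := ht0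
  -- `f` is below `f p` at an interior or end point of the segment, hence also at `μ`. As `μ` was
  -- arbitrary, `p` is outside the larger hull too.
  change f μ < f p
  by_contra! hge
  have := mul_nonneg ht0'.le (sub_nonneg.2 hge)
  linarith

/-- For a nearly optimal mediator, `ℓ - V` is small in mean and, by truth-telling, `ℓ - v` is small
in mean square. Hence `V ≥ s` outside small mass, and a functional `f` strictly separating `p` from
the hull cannot have mean `f p`. -/
theorem mem_convexHull_of_lt_valueBP (huS : Continuous uS) (huR : ∀ ω, Continuous (uR ω))
    (hp : ∀ ω, 0 < (p : Ω → ℝ) ω) (hle : valueBP uS uR p ≤ valueMD uS uR p) {s : ℝ}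
    (hs : s < valueBP uS uR p) :
    (p : Ω → ℝ) ∈ convexHull ℝ (Subtype.val '' {μ : Belief Ω | s ≤ upperValue uS uR μ}) := by
  obtain ⟨B, hB⟩ := exists_bound_valueCorr (uR := uR) huS
  obtain ⟨ℓ, hℓ, hℓp⟩ := exists_linear_majorant (measurable_upperValue huS huR)
    (fun μ => hB μ _ (upperValue_mem huS huR μ)) hp
    fun τ hτ => integral_upperValue_le_valueBP (p := p) huS huR hτ
  set v := valueBP uS uR p
  by_contra hnot
  have hK := isClosed_le_upperValue (Ω := Ω) huS huR s
  obtain ⟨f, u, hfu, hup⟩ := geometric_hahn_banach_closed_point (convex_convexHull ℝ _)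
    (isCompact_convexHull (hK.isCompact.image continuous_subtype_val)).isClosed hnot
  have hfc : Continuous fun μ : Belief Ω => f μ := f.continuous.comp continuous_subtype_val
  have hℓc := continuous_linear_belief ℓ
  obtain ⟨C, hC⟩ := isCompact_univ.exists_bound_of_continuousOn
    ((continuous_const.sub hfc : Continuous fun μ : Belief Ω => f p - f μ).continuousOn)
  obtain ⟨D, hD⟩ := isCompact_univ.exists_bound_of_continuousOn
    ((hℓc.sub continuous_const : Continuous fun μ : Belief Ω => ℓ μ - v).continuousOn)
  have hC' : ∀ μ : Belief Ω, |f p - f μ| ≤ C := fun μ => hC μ trivial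
  have hD' : ∀ μ : Belief Ω, |ℓ μ - v| ≤ D := fun μ => hD μ trivial
  have hC0 : 0 ≤ C := (abs_nonneg _).trans (hC' p)
  have hD0 : 0 ≤ D := (abs_nonneg _).trans (hD' p)
  obtain ⟨γ, hγ0, hγ⟩ : ∃ γ : ℝ, 0 < γ ∧ f p - u = γ := ⟨_, sub_pos.2 hup, rfl⟩
  obtain ⟨δ, hδ0, hδ⟩ : ∃ δ : ℝ, 0 < δ ∧ v - s = 2 * δ :=
    -- Half the gap: `V < s` forces `ℓ - V ≥ δ` or `v - ℓ ≥ δ`. The weight `κ` then makes the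
    -- penalty at least `C + γ`, outweighing the worst case `f p - f μ ≥ -C`; `ε` keeps the expected
    -- penalty below `γ`.
    ⟨(v - s) / 2, half_pos (sub_pos.2 hs), by ring⟩
  obtain ⟨κ, hκ0, hκ⟩ : ∃ κ : ℝ, 0 < κ ∧ κ * δ ^ 2 = C + γ :=
    ⟨(C + γ) / δ ^ 2, by positivity, by field_simp⟩
  obtain ⟨ε, hε0, hε⟩ : ∃ ε : ℝ, 0 < ε ∧ κ * (δ + D) * ε < γ :=
    ⟨γ / (2 * (κ * (δ + D))), by positivity, by field_simp; linarith⟩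
  obtain ⟨_, ⟨τ, hτ, V, hV, htt, rfl⟩, hVε⟩ := exists_lt_of_lt_csSup
    (s := {s | ∃ τ ∈ feasibleBP p, ∃ V, IsSelection uS uR V ∧
    (∀ ω, ∫ μ, V μ * ((μ : Ω → ℝ) ω - (p : Ω → ℝ) ω) ∂(τ : Measure (Belief Ω)) = 0) ∧
    ∫ μ, V μ ∂(τ : Measure (Belief Ω)) = s})
    ⟨_, _, dirac_mem_feasibleBP p, _, isSelection_upperValue huS huR,
      (isCheapTalk_dirac huS huR).truthTelling, rfl⟩ (lt_of_lt_of_le (sub_lt_self v hε0) hle)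
  have hVℓ : ∀ μ : Belief Ω, V μ ≤ ℓ μ := fun μ =>
    (le_upperValue huS huR (hV.2 μ)).trans (hℓ μ)
  have hpt : ∀ μ : Belief Ω,
      γ - κ * ((δ + D) * (ℓ μ - V μ) + (V μ * (ℓ μ - v) - v * (ℓ μ - v))) ≤ f p - f μ := by
    intro μ
    have h1 := hVℓ μ
    have h2 := abs_le.1 (hD' μ)
    have h3 := abs_le.1 (hC' μ)
    -- Since `(V - v)(ℓ - v) = (ℓ - v)² - (ℓ - V)(ℓ - v)`, the bound `ℓ - v ≤ D` suffices.
    have hlow : δ * (ℓ μ - V μ) + (ℓ μ - v) ^ 2 ≤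
        (δ + D) * (ℓ μ - V μ) + (V μ * (ℓ μ - v) - v * (ℓ μ - v)) := by
      nlinarith [mul_nonneg (sub_nonneg.2 h1) (sub_nonneg.2 h2.2)]
    by_cases hμ : s ≤ upperValue uS uR μ
    · have h4 : f μ < u := hfu _ (subset_convexHull ℝ _ ⟨μ, hμ, rfl⟩)
      have h5 : 0 ≤ δ * (ℓ μ - V μ) + (ℓ μ - v) ^ 2 := by
        have := mul_nonneg hδ0.le (sub_nonneg.2 h1)
        positivity
      have := mul_nonneg hκ0.le (h5.trans hlow)
      linarith
    · have h4 : V μ < s := (le_upperValue huS huR (hV.2 μ)).trans_lt (not_le.1 hμ)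
      have h5 : δ ^ 2 ≤ δ * (ℓ μ - V μ) + (ℓ μ - v) ^ 2 := by
        rcases le_total δ (ℓ μ - V μ) with h | h
        · nlinarith [sq_nonneg (ℓ μ - v)]
        · have : δ ≤ v - ℓ μ := by linarith
          nlinarith [mul_nonneg hδ0.le (sub_nonneg.2 h1)]
      have := mul_le_mul_of_nonneg_left (h5.trans hlow) hκ0.le
      linarith
  have hVi := hV.integrable huS (τ : Measure (Belief Ω))
  have hint : ∀ g : Belief Ω → ℝ, Continuous g → Integrable g (τ : Measure (Belief Ω)) :=
    fun g hg => hg.integrable_of_hasCompactSupport (HasCompactSupport.of_compactSpace _)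
  have hℓi := hint _ hℓc
  have hfi := hint _ hfc
  have hℓvi : Integrable (fun μ : Belief Ω => ℓ μ - v) (τ : Measure (Belief Ω)) :=
    hint _ (hℓc.sub continuous_const)
  have hVℓi : Integrable (fun μ : Belief Ω => V μ * (ℓ μ - v)) (τ : Measure (Belief Ω)) :=
    hℓvi.bdd_mul hV.1.aestronglyMeasurable
      (Filter.Eventually.of_forall fun μ => hB μ _ (hV.2 μ))
  have e1 := integral_linear hτ ℓ
  have e2 := integral_linear hτ f.toLinearMap
  have e3 := integral_mul_linear_sub hV.1 (fun μ => hB μ _ (hV.2 μ)) htt ℓ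
  rw [hℓp] at e1 e3
  have i1 : Integrable (fun μ : Belief Ω => (δ + D) * (ℓ μ - V μ)) (τ : Measure (Belief Ω)) :=
    (hℓi.sub hVi).const_mul (δ + D)
  have i2 : Integrable (fun μ : Belief Ω => V μ * (ℓ μ - v) - v * (ℓ μ - v))
      (τ : Measure (Belief Ω)) := hVℓi.sub (hℓvi.const_mul v)
  have i3 : Integrable (fun μ : Belief Ω =>
      κ * ((δ + D) * (ℓ μ - V μ) + (V μ * (ℓ μ - v) - v * (ℓ μ - v))))
      (τ : Measure (Belief Ω)) := (i1.add i2).const_mul κ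
  have hmono := integral_mono ((integrable_const γ).sub i3)
    ((integrable_const (f p)).sub hfi) hpt
  have r1 : ∫ μ : Belief Ω, f p - f μ ∂(τ : Measure (Belief Ω)) = 0 := by
    rw [integral_sub (integrable_const _) hfi]
    simpa using sub_eq_zero.2 e2.symm
  have r2 : ∫ μ : Belief Ω, γ - κ * ((δ + D) * (ℓ μ - V μ) + (V μ * (ℓ μ - v) - v * (ℓ μ - v)))
      ∂(τ : Measure (Belief Ω)) =
      γ - κ * ((δ + D) * (v - ∫ μ, V μ ∂(τ : Measure (Belief Ω)))) := by
    -- Truth-telling cancels the `V (ℓ - v)` term and the mean condition the `v (ℓ - v)` term,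
    -- leaving only the optimality gap.
    have a1 : ∫ μ : Belief Ω, ((δ + D) * (ℓ μ - V μ) + (V μ * (ℓ μ - v) - v * (ℓ μ - v)))
        ∂(τ : Measure (Belief Ω)) =
        (δ + D) * (v - ∫ μ, V μ ∂(τ : Measure (Belief Ω))) := by
      rw [integral_add i1 i2, integral_const_mul, integral_sub hℓi hVi, e1,
        integral_sub hVℓi (hℓvi.const_mul v), e3, integral_const_mul,
        integral_sub hℓi (integrable_const _), e1]
      simp
    rw [integral_sub (integrable_const _) i3, integral_const_mul, a1]
    simp
  have hfin := (r2.symm.trans_le (hmono.trans_eq r1))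
  have : κ * (δ + D) * (v - ∫ μ, V μ ∂(τ : Measure (Belief Ω))) ≤ κ * (δ + D) * ε :=
    mul_le_mul_of_nonneg_left (by linarith) (by positivity)
  linarith

end Values

/-! ### Full dimensionality, the global maximum and the quasiconcave envelope. -/

section Comparison

variable {Ω A : Type*} [Fintype Ω] [MetricSpace A] [CompactSpace A] [Nonempty A]
  {uS : A → ℝ} {uR : Ω → A → ℝ} {p : Belief Ω}

theorem valueBP_le_valueCT (huS : Continuous uS) (huR : ∀ ω, Continuous (uR ω))
    (hp : ∀ ω, 0 < (p : Ω → ℝ) ω) (hle : valueBP uS uR p ≤ valueMD uS uR p) :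
    valueBP uS uR p ≤ valueCT uS uR p :=
  le_of_forall_lt_imp_le_of_dense fun _ hs =>
    le_valueCT_of_mem_convexHull huS huR (mem_convexHull_of_lt_valueBP huS huR hp hle hs)

theorem upperValue_le_valueCT (huS : Continuous uS) (huR : ∀ ω, Continuous (uR ω))
    (hp : ∀ ω, 0 < (p : Ω → ℝ) ω) (hfull : FullDimensional uS uR p)
    (hle : valueBP uS uR p ≤ valueMD uS uR p) (μ : Belief Ω) :
    upperValue uS uR μ ≤ valueCT uS uR p := by
  obtain ⟨B, hB⟩ := exists_bound_valueCorr (uR := uR) huS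
  obtain ⟨ℓ, hℓ, hℓp⟩ := exists_linear_majorant (measurable_upperValue huS huR)
    (fun μ => hB μ _ (upperValue_mem huS huR μ)) hp
    fun τ hτ => integral_upperValue_le_valueBP (p := p) huS huR hτ
  have hBC := valueBP_le_valueCT huS huR hp hle
  obtain ⟨τ, ⟨_, hτ, -⟩, hval, -, hμ, -⟩ : (μ : Ω → ℝ) ∈ cheapTalkHull uS uR p
      (valueCT uS uR p) := by
    rw [show cheapTalkHull uS uR p (valueCT uS uR p) = _ from hfull]
    exact μ.2
  -- `ℓ` dominates the cheap talk value on the support, and that value is at least `v = ℓ p`. As `ℓ`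
  -- has mean `ℓ p`, equality must hold throughout the support.
  have hge : ∀ ν ∈ supp τ, ℓ (p : Ω → ℝ) ≤ ℓ (ν : Ω → ℝ) := fun ν hν =>
    hℓp.trans_le <| hBC.trans <| (le_upperValue huS huR (hval ν hν)).trans (hℓ ν)
  have hℓc := continuous_linear_belief ℓ
  have hℓi : Integrable (fun ν : Belief Ω => ℓ (ν : Ω → ℝ)) (τ : Measure (Belief Ω)) :=
    hℓc.integrable_of_hasCompactSupport (HasCompactSupport.of_compactSpace _)
  have hsupp : supp τ ⊆ {ν : Belief Ω | ℓ (ν : Ω → ℝ) = ℓ (p : Ω → ℝ)} := by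
    refine Measure.support_subset_of_isClosed (isClosed_eq hℓc continuous_const) ?_
    have hae : 0 ≤ᵐ[(τ : Measure (Belief Ω))] fun ν : Belief Ω =>
        ℓ (ν : Ω → ℝ) - ℓ (p : Ω → ℝ) := by
      filter_upwards [Measure.support_mem_ae (μ := (τ : Measure (Belief Ω)))] with ν hν
      exact sub_nonneg.2 (hge ν hν)
    have h0 : ∫ ν : Belief Ω, ℓ (ν : Ω → ℝ) - ℓ (p : Ω → ℝ) ∂(τ : Measure (Belief Ω)) = 0 := by
      rw [integral_sub hℓi (integrable_const _), integral_linear hτ ℓ]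
      simp
    filter_upwards [(integral_eq_zero_iff_of_nonneg_ae hae
      (hℓi.sub (integrable_const _))).1 h0] with ν hν
    exact sub_eq_zero.1 hν
  have hμℓ : ℓ (μ : Ω → ℝ) = ℓ (p : Ω → ℝ) := by
    have hsub : affineSpan ℝ (Subtype.val '' supp τ) ≤
        (AffineSubspace.mk' (ℓ (p : Ω → ℝ)) (⊥ : Submodule ℝ ℝ)).comap ℓ.toAffineMap := by
      refine affineSpan_le.2 ?_
      rintro _ ⟨ν, hν, rfl⟩
      have h : ℓ ν.val = ℓ (p : Ω → ℝ) := hsupp hν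
      simpa [AffineSubspace.mem_mk', sub_eq_zero] using h
    simpa [AffineSubspace.mem_mk', sub_eq_zero] using hsub hμ
  exact (hℓ μ).trans ((hμℓ.trans hℓp).trans_le hBC)

theorem valueMD_lt_valueBP_iff (huS : Continuous uS) (huR : ∀ ω, Continuous (uR ω))
    (hp : ∀ ω, 0 < (p : Ω → ℝ) ω) (hfull : FullDimensional uS uR p) :
    valueMD uS uR p < valueBP uS uR p ↔ ∃ μ, valueCT uS uR p < upperValue uS uR μ := by
  constructor
  · contrapose!
    exact fun h => (valueBP_le huS huR h).trans (valueCT_le_valueMD huS huR)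
  · contrapose!
    exact upperValue_le_valueCT huS huR hp hfull

theorem isGreatest_valueCT_iff (huS : Continuous uS) (huR : ∀ ω, Continuous (uR ω)) :
    IsGreatest (Set.range (upperValue uS uR)) (valueCT uS uR p) ↔
      ∀ μ, upperValue uS uR μ ≤ valueCT uS uR p := by
  refine ⟨fun h μ => h.2 ⟨μ, rfl⟩, fun h => ⟨?_, Set.forall_mem_range.2 h⟩⟩
  have : Nonempty (Belief Ω) := ⟨p⟩
  obtain ⟨μ₀, hμ₀⟩ := exists_isMax_upperValue (Ω := Ω) huS huR
  refine ⟨μ₀, (h μ₀).antisymm (valueCT_le_of_forall huS huR fun τ V hV => ?_)⟩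
  exact integral_le_of_forall_le (hV.2.1.integrable huS _)
    fun μ => (le_upperValue huS huR (hV.2.1.2 μ)).trans (hμ₀ μ)

/-- A cheap talk outcome of value `c` is supported in the superlevel set of `q` at `c`, which is
convex and so contains the barycenter `p`. -/
theorem valueCT_le_of_quasiconcaveOn (huS : Continuous uS) (huR : ∀ ω, Continuous (uR ω))
    {q : (Ω → ℝ) → ℝ} (hq : QuasiconcaveOn ℝ (stdSimplex ℝ Ω) q)
    (hVq : ∀ ν : Belief Ω, upperValue uS uR ν ≤ q ν) : valueCT uS uR p ≤ q p := by
  refine valueCT_le_of_forall huS huR fun τ V ⟨hτ, hV, c, hc⟩ => ?_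
  rw [integral_eq_of_eqOn_supp hc]
  have hsub : Subtype.val '' supp τ ⊆ {x ∈ stdSimplex ℝ Ω | c ≤ q x} := by
    rintro _ ⟨ν, hν, rfl⟩
    exact ⟨ν.2, (hc ν hν).ge.trans ((le_upperValue huS huR (hV.2 ν)).trans (hVq ν))⟩
  exact (convexHull_min hsub (hq c) (mem_convexHull_of_supp_subset hτ
    Measure.isClosed_support subset_rfl)).2

/-- The quasiconcave envelope of the upper value is the cheap talk value. -/
theorem quasiconcaveEnvelope_eq_valueCT (huS : Continuous uS) (huR : ∀ ω, Continuous (uR ω)) :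
    quasiconcaveEnvelope uS uR p = valueCT uS uR p := by
  classical
  have : Nonempty (Belief Ω) := ⟨p⟩
  obtain ⟨μ₀, hμ₀⟩ := exists_isMax_upperValue (Ω := Ω) huS huR
  set M := upperValue uS uR μ₀
  -- Two-step functions are the competitors: `M` on the hull of the beliefs with upper value at
  -- least `s`, and `s` elsewhere. For `s` above the cheap talk value, `p` is off that hull, so the
  -- envelope at `p` is at most `s`.
  have hquasi : ∀ s ≤ M, ∀ C : Set (Ω → ℝ), Convex ℝ C →
      QuasiconcaveOn ℝ (stdSimplex ℝ Ω) fun x => if x ∈ C then M else s := by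
    intro s hs C hC r
    have hset : {x ∈ stdSimplex ℝ Ω | r ≤ if x ∈ C then M else s} =
        stdSimplex ℝ Ω ∩ if r ≤ s then Set.univ else if r ≤ M then C else ∅ := by
      ext x
      by_cases hx : x ∈ C <;> by_cases h1 : r ≤ s <;> by_cases h2 : r ≤ M <;>
        simp [hx, h1, h2]
      exact fun _ => h2 (h1.trans hs)
    rw [hset]
    refine (convex_stdSimplex ℝ Ω).inter ?_
    split_ifs
    exacts [convex_univ, hC, convex_empty]
  have hlb : ∀ r ∈ {r | ∃ q : (Ω → ℝ) → ℝ, QuasiconcaveOn ℝ (stdSimplex ℝ Ω) q ∧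
      (∀ ν : Belief Ω, upperValue uS uR ν ≤ q ν) ∧ q p = r}, valueCT uS uR p ≤ r := by
    rintro _ ⟨q, hq, hVq, rfl⟩
    exact valueCT_le_of_quasiconcaveOn huS huR hq hVq
  apply le_antisymm
  · refine le_of_forall_gt_imp_ge_of_dense fun s hs => ?_
    rcases le_or_gt s M with hsM | hsM
    · have hnot : (p : Ω → ℝ) ∉ convexHull ℝ
          (Subtype.val '' {μ : Belief Ω | s ≤ upperValue uS uR μ}) := fun h =>
        not_le.2 hs (le_valueCT_of_mem_convexHull huS huR h)
      refine csInf_le ⟨_, hlb⟩ ⟨_, hquasi s hsM _ (convex_convexHull ℝ _), fun ν => ?_,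
        if_neg hnot⟩
      split_ifs with h
      · exact hμ₀ ν
      · exact (not_le.1 fun hle => h (subset_convexHull ℝ _ ⟨ν, hle, rfl⟩)).le
    · refine (csInf_le ⟨_, hlb⟩ ⟨_, hquasi M le_rfl _ convex_univ, fun ν => ?_, rfl⟩).trans ?_
      · simpa using hμ₀ ν
      · simpa using hsM.le
  · exact le_csInf ⟨_, _, hquasi M le_rfl _ convex_univ, fun ν => by simpa using hμ₀ ν, rfl⟩ hlb

end Comparison

end Mediation

theorem corollary4 {Ω A : Type*} [Fintype Ω] [MetricSpace A] [CompactSpace A] [Nonempty A]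
    (uS : A → ℝ) (huS : Continuous uS)
    (uR : Ω → A → ℝ) (huR : ∀ ω, Continuous (uR ω))
    (p : Mediation.Belief Ω) (hp : ∀ ω, 0 < (p : Ω → ℝ) ω)
    (hfull : Mediation.FullDimensional uS uR p) :
    (Mediation.valueBP uS uR p > Mediation.valueMD uS uR p ↔
      ∃ μ : Mediation.Belief Ω,
        Mediation.upperValue uS uR μ > Mediation.quasiconcaveEnvelope uS uR p) ∧
    (Mediation.valueBP uS uR p > Mediation.valueMD uS uR p ↔
      ¬ IsGreatest (Set.range (Mediation.upperValue uS uR)) (Mediation.valueCT uS uR p)) := by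
  have h := Mediation.valueMD_lt_valueBP_iff huS huR hp hfull
  rw [Mediation.quasiconcaveEnvelope_eq_valueCT huS huR, Mediation.isGreatest_valueCT_iff huS huR]
  refine ⟨h, h.trans ?_⟩
  push Not
  rfl
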